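/- Let $G$ be a finite group and let $C$ be a cyclic group of order $|G|$. For a finite group $H$, let $B(H)$ denote the Burnside ring of $H$, that is, the Grothendieck ring of finite $H$-sets (addition is induced by disjoint union, multiplication by cartesian product); for $U\leqslant H$ let $x\mapsto |x^U|$ denote the ring homomorphism $B(H)\to\mathbb{Z}$ induced by $X\mapsto |X^U|$, the number of $U$-fixed points. Let $\alpha^G\colon B(C)\to B(G)$ be the Frobenius--Wielandt homomorphism, i.e. the unique ring homomorphism such that $|\alpha^G(x)^U| = |x^{C_{|U|}}|$ for every subgroup $U\leqslant G$ and every $x\in B(C)$, where $C_{|U|}$ is the unique subgroup of $C$ of order $|U|$. A subgroup $N\leqslant G$ is said to satisfy the gcd property if $|H\cap N|=\gcd(|H|,|N|)$ for every subgroup $H\leqslant G$. Let $D$ be a subgroup of $C$ and $N$ a subgroup of $G$. Then $\alpha^G([C/D])=[G/N]$ in $B(G)$ if and only if $|N|=|D|$ and $N$ satisfies the gcd property. -/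

import Mathlib

universe u v

/-- A finite (left) `G`-set. -/
structure FinGSet (G : Type u) [Group G] : Type (u + 1) where
  carrier : Type u
  [fin : Finite carrier]
  [act : MulAction G carrier]

namespace FinGSet

attribute [instance] FinGSet.fin FinGSet.act

variable {G : Type u} [Group G]

/-- Two `G`-sets are isomorphic when there is a `G`-equivariant bijection between them. -/
def Iso (X Y : FinGSet G) : Prop :=
  ∃ e : X.carrier ≃ Y.carrier, ∀ (g : G) (x : X.carrier), e (g • x) = g • e x

instance isoSetoid (G : Type u) [Group G] : Setoid (FinGSet G) where
  r := Iso
  iseqv :=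
    { refl := fun _ => ⟨Equiv.refl _, fun _ _ => rfl⟩
      symm := fun ⟨e, he⟩ => ⟨e.symm, fun g x => by
        rw [Equiv.symm_apply_eq, he, Equiv.apply_symm_apply]⟩
      trans := fun ⟨e, he⟩ ⟨f, hf⟩ => ⟨e.trans f, fun g x => by
        simp [he, hf]⟩ }

/-- The cartesian product, with the diagonal action. -/
def prod (X Y : FinGSet G) : FinGSet G := ⟨X.carrier × Y.carrier⟩

/-- The disjoint union. -/
def sum (X Y : FinGSet G) : FinGSet G := ⟨X.carrier ⊕ Y.carrier⟩

/-- The one-point `G`-set. -/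
def point (G : Type u) [Group G] : FinGSet G :=
  letI : MulAction G PUnit.{u + 1} :=
    { smul := fun _ x => x, one_smul := fun _ => rfl, mul_smul := fun _ _ _ => rfl }
  ⟨PUnit.{u + 1}⟩

end FinGSet

/-- Isomorphism classes of finite `G`-sets. -/
def GSetClass (G : Type u) [Group G] : Type (u + 1) := Quotient (FinGSet.isoSetoid G)

namespace GSetClass

variable {G : Type u} [Group G]

/-- The isomorphism class of a finite `G`-set. -/
def mk (X : FinGSet G) : GSetClass G := Quotient.mk _ X

/-- Isomorphism classes of finite `G`-sets form a commutative monoid under cartesian product. -/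
instance : CommMonoid (GSetClass G) where
  mul := Quotient.map₂ FinGSet.prod (by
    rintro X X' ⟨e, he⟩ Y Y' ⟨f, hf⟩
    exact ⟨Equiv.prodCongr e f, fun g x => Prod.ext (he g x.1) (hf g x.2)⟩)
  one := mk (FinGSet.point G)
  mul_assoc := by
    rintro ⟨X⟩ ⟨Y⟩ ⟨Z⟩
    exact Quotient.sound ⟨Equiv.prodAssoc _ _ _, fun _ _ => rfl⟩
  one_mul := by
    rintro ⟨X⟩
    exact Quotient.sound ⟨Equiv.punitProd _, fun _ _ => rfl⟩
  mul_one := by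
    rintro ⟨X⟩
    exact Quotient.sound ⟨Equiv.prodPUnit _, fun _ _ => rfl⟩
  mul_comm := by
    rintro ⟨X⟩ ⟨Y⟩
    exact Quotient.sound ⟨Equiv.prodComm _ _, fun _ _ => rfl⟩

end GSetClass

/-- The relations `[X ⊔ Y] = [X] + [Y]` of the Burnside ring. Since `×` distributes over `⊔`, the
ideal generated by the differences is the additive subgroup generated by them. -/
noncomputable def burnsideIdeal (G : Type u) [Group G] : Ideal (MonoidAlgebra ℤ (GSetClass G)) :=
  Ideal.span {z | ∃ X Y : FinGSet G,
    z = MonoidAlgebra.of ℤ _ (GSetClass.mk (X.sum Y))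
      - MonoidAlgebra.of ℤ _ (GSetClass.mk X) - MonoidAlgebra.of ℤ _ (GSetClass.mk Y)}

/-- The Burnside ring `B(G)`: the Grothendieck ring of finite `G`-sets, with addition given by
disjoint union and multiplication given by cartesian product. -/
abbrev BurnsideRing (G : Type u) [Group G] : Type (u + 1) :=
  MonoidAlgebra ℤ (GSetClass G) ⧸ burnsideIdeal G

namespace BurnsideRing

section

variable {G : Type u} [Group G]

/-- The class `[X]` in `B(G)` of a finite `G`-set `X`. -/
noncomputable def of (G : Type u) [Group G] (X : Type u) [Finite X] [MulAction G X] :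
    BurnsideRing G :=
  Ideal.Quotient.mk _ (MonoidAlgebra.of ℤ _ (GSetClass.mk (⟨X⟩ : FinGSet G)))

/-- The class `[G/H]` in `B(G)` of the transitive `G`-set `G/H`. -/
noncomputable def transitive [Finite G] (H : Subgroup G) : BurnsideRing G := of G (G ⧸ H)

/-- The number `|X^U|` of `U`-fixed points, as a monoid homomorphism on isomorphism classes. -/
noncomputable def fixMonoidHom (U : Subgroup G) : GSetClass G →* ℤ where
  toFun := Quotient.lift (fun X : FinGSet G => (Nat.card (MulAction.fixedPoints U X.carrier) : ℤ))
    (by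
      rintro X Y ⟨e, he⟩
      refine congrArg Nat.cast (Nat.card_congr (e.subtypeEquiv fun x => ?_))
      refine forall_congr' fun g => ?_
      have := he g x
      change (g : G) • x = x ↔ (g : G) • e x = e x
      rw [← this, e.apply_eq_iff_eq])
  map_one' := by
    change ((Nat.card (MulAction.fixedPoints U (FinGSet.point G).carrier) : ℕ) : ℤ) = 1
    have : MulAction.fixedPoints U (FinGSet.point G).carrier = Set.univ :=
      Set.eq_univ_of_forall fun x g => rfl
    rw [this, Nat.card_univ]
    exact congrArg Nat.cast (Nat.card_unique (α := PUnit))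
  map_mul' := by
    rintro ⟨X⟩ ⟨Y⟩
    change ((Nat.card (MulAction.fixedPoints U (X.carrier × Y.carrier)) : ℕ) : ℤ) =
      (Nat.card (MulAction.fixedPoints U X.carrier) : ℤ)
        * (Nat.card (MulAction.fixedPoints U Y.carrier) : ℤ)
    rw [← Nat.cast_mul, ← Nat.card_prod]
    refine congrArg Nat.cast (Nat.card_congr ?_)
    refine Equiv.trans (Equiv.subtypeEquivRight fun x => ?_) (Equiv.subtypeProdEquivProd
      (p := (· ∈ MulAction.fixedPoints U X.carrier)) (q := (· ∈ MulAction.fixedPoints U Y.carrier)))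
    simp only [MulAction.mem_fixedPoints, Prod.ext_iff, Prod.smul_fst, Prod.smul_snd, forall_and]

theorem card_fixedPoints_sum (U : Subgroup G) (X Y : Type u) [Finite X] [Finite Y] [MulAction G X]
    [MulAction G Y] : Nat.card (MulAction.fixedPoints U (X ⊕ Y)) =
      Nat.card (MulAction.fixedPoints U X) + Nat.card (MulAction.fixedPoints U Y) := by
  rw [← Nat.card_sum]
  refine Nat.card_congr (Equiv.trans (Equiv.subtypeSum) (Equiv.sumCongr ?_ ?_))
  · exact Equiv.subtypeEquivRight fun x => forall_congr' fun g => Sum.inl_injective.eq_iff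
  · exact Equiv.subtypeEquivRight fun x => forall_congr' fun g => Sum.inr_injective.eq_iff

/-- The ring homomorphism of fixed points `B(G) → ℤ`, `x ↦ |x^U|`. -/
noncomputable def fix (U : Subgroup G) : BurnsideRing G →+* ℤ :=
  Ideal.Quotient.lift (burnsideIdeal G)
    (MonoidAlgebra.lift ℤ ℤ (GSetClass G) (fixMonoidHom U)).toRingHom (by
      intro a ha
      rw [← RingHom.mem_ker]
      refine (Ideal.span_le.2 ?_ : burnsideIdeal G ≤ _) ha
      rintro _ ⟨X, Y, rfl⟩
      have h : fixMonoidHom U (GSetClass.mk (X.sum Y))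
          = fixMonoidHom U (GSetClass.mk X) + fixMonoidHom U (GSetClass.mk Y) :=
        (congrArg Nat.cast (card_fixedPoints_sum U X.carrier Y.carrier)).trans (Nat.cast_add _ _)
      simp [RingHom.mem_ker, MonoidAlgebra.lift_single, h])

theorem fix_of (U : Subgroup G) (X : Type u) [Finite X] [MulAction G X] :
    fix U (of G X) = Nat.card (MulAction.fixedPoints U X) := by
  simp only [fix, of, Ideal.Quotient.lift_mk]
  exact MonoidAlgebra.lift_of _ _

theorem of_congr {X Y : Type u} [Finite X] [MulAction G X] [Finite Y] [MulAction G Y]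
    (e : X ≃ Y) (he : ∀ (g : G) (x : X), e (g • x) = g • e x) : of G X = of G Y := by
  have : GSetClass.mk (⟨X⟩ : FinGSet G) = GSetClass.mk (⟨Y⟩ : FinGSet G) :=
    Quotient.sound ⟨e, he⟩
  rw [of, of, this]

theorem of_sum (X Y : Type u) [Finite X] [MulAction G X] [Finite Y] [MulAction G Y] :
    of G (X ⊕ Y) = of G X + of G Y := by
  rw [← sub_eq_zero, ← sub_sub]
  exact Ideal.Quotient.eq_zero_iff_mem.2 (Ideal.subset_span ⟨⟨X⟩, ⟨Y⟩, rfl⟩)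

theorem of_isEmpty (X : Type u) [Finite X] [MulAction G X] [IsEmpty X] : of G X = 0 := by
  have h := of_sum (G := G) X X
  rw [of_congr (G := G) (Equiv.equivOfIsEmpty (X ⊕ X) X) (fun g x => isEmptyElim x)] at h
  simpa using h

theorem mem_of_forall_of_mem (S : AddSubgroup (BurnsideRing G))
    (h : ∀ (X : Type u) [Finite X] [MulAction G X], of G X ∈ S) (x : BurnsideRing G) : x ∈ S := by
  obtain ⟨x, rfl⟩ := Ideal.Quotient.mk_surjective x
  induction x using MonoidAlgebra.induction_on with
  | of m =>
    obtain ⟨X⟩ := m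
    exact h X.carrier
  | add f g hf hg => rw [map_add]; exact S.add_mem hf hg
  | smul r f hf =>
    rw [map_zsmul]
    exact S.zsmul_mem hf r

/-- The complement of an orbit. -/
def orbitCompl {X : Type u} [MulAction G X] (x : X) : SubMulAction G X where
  carrier := (MulAction.orbit G x)ᶜ
  smul_mem' g y hy h := hy (by
    have := MulAction.mem_orbit_of_mem_orbit (g⁻¹) h
    rwa [inv_smul_smul] at this)

theorem of_orbit [Finite G] {X : Type u} [Finite X] [MulAction G X] (x : X) :
    of G (MulAction.orbit G x) = transitive (MulAction.stabilizer G x) := by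
  refine (of_congr (MulAction.orbitEquivQuotientStabilizer G x).symm ?_).symm
  intro g y
  induction y using QuotientGroup.induction_on with
  | H h =>
    apply Subtype.ext
    change ((MulAction.orbitEquivQuotientStabilizer G x).symm ((g * h : G) : G ⧸ _) : X) = _
    rw [MulAction.orbitEquivQuotientStabilizer_symm_apply, MulAction.orbit.coe_smul,
      MulAction.orbitEquivQuotientStabilizer_symm_apply, mul_smul]

theorem of_eq_add_orbitCompl [Finite G] {X : Type u} [Finite X] [MulAction G X] (x : X) :
    of G X = transitive (MulAction.stabilizer G x) + of G (orbitCompl (G := G) x) := by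
  classical
  rw [← of_orbit, ← of_sum]
  refine (of_congr (X := MulAction.orbit G x ⊕ orbitCompl (G := G) x)
    (Equiv.sumCompl (· ∈ MulAction.orbit G x)) ?_).symm
  rintro g (y | y) <;> rfl

theorem of_mem [Finite G] (S : AddSubgroup (BurnsideRing G)) (n : ℕ) :
    ∀ (X : Type u) [Finite X] [MulAction G X], Nat.card X = n →
      (∀ x : X, transitive (MulAction.stabilizer G x) ∈ S) → of G X ∈ S := by
  induction n using Nat.strong_induction_on with
  | _ n ih =>
    intro X _ _ hn h
    rcases isEmpty_or_nonempty X with hX | ⟨⟨x⟩⟩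
    · rw [of_isEmpty]
      exact S.zero_mem
    · rw [of_eq_add_orbitCompl x]
      refine S.add_mem (h x) (ih _ ?_ _ rfl fun y => ?_)
      · rw [← hn]
        exact Finite.card_subtype_lt (x := x) (fun hx => hx (MulAction.mem_orbit_self x))
      · have := h y
        rwa [← SubMulAction.stabilizer_of_subMul] at this

theorem mem_span_transitive [Finite G] (x : BurnsideRing G) :
    x ∈ Submodule.span ℤ (Set.range (transitive (G := G))) :=
  mem_of_forall_of_mem (Submodule.span ℤ (Set.range (transitive (G := G)))).toAddSubgroup
    (fun X _ _ => of_mem _ _ X rfl fun _ => Submodule.subset_span ⟨_, rfl⟩) x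

theorem fix_transitive_self_ne_zero [Finite G] (H : Subgroup G) : fix H (transitive H) ≠ 0 := by
  rw [transitive, fix_of, Nat.cast_ne_zero, Nat.card_ne_zero]
  refine ⟨⟨⟨((1 : G) : G ⧸ H), fun h => ?_⟩⟩, inferInstance⟩
  change (((h : G) * 1 : G) : G ⧸ H) = _
  rw [QuotientGroup.eq]
  simp

theorem card_stabilizer_quotient [Finite G] (H : Subgroup G) (y : G ⧸ H) :
    Nat.card (MulAction.stabilizer G y) = Nat.card H := by
  have h1 := (MulAction.stabilizer G y).card_mul_index
  rw [MulAction.index_stabilizer, MulAction.orbit_eq_univ, Set.ncard_univ, ← H.card_mul_index] at h1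
  exact Nat.eq_of_mul_eq_mul_right (Nat.pos_of_ne_zero H.index_ne_zero_of_finite) h1

theorem card_le_of_fix_ne_zero [Finite G] {K H : Subgroup G} (h : fix K (transitive H) ≠ 0) :
    Nat.card K ≤ Nat.card H ∧ (Nat.card H ≤ Nat.card K → transitive K = transitive H) := by
  rw [transitive, fix_of, Nat.cast_ne_zero, Nat.card_ne_zero] at h
  obtain ⟨⟨⟨y, hy⟩⟩, -⟩ := h
  have hle : K ≤ MulAction.stabilizer G y := fun k hk => hy ⟨k, hk⟩
  refine ⟨?_, fun hKH => ?_⟩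
  · rw [← card_stabilizer_quotient H y]
    exact Subgroup.card_le_of_le hle
  · rw [← card_stabilizer_quotient H y] at hKH
    rw [Subgroup.eq_of_le_of_card_ge hle hKH, ← of_orbit, transitive]
    exact of_congr ((Equiv.setCongr (MulAction.orbit_eq_univ G y)).trans (Equiv.Set.univ _))
      fun _ _ => rfl

/-- An element of `B(G)` is determined by its numbers of fixed points. -/
theorem eq_zero_of_fix [Finite G] (x : BurnsideRing G) (hx : ∀ U : Subgroup G, fix U x = 0) :
    x = 0 := by
  classical
  have : Fintype (Set.range (transitive (G := G))) := Fintype.ofFinite _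
  have hspan := mem_span_transitive x
  rw [← Subtype.range_coe (s := Set.range (transitive (G := G))),
    Submodule.mem_span_range_iff_exists_fun] at hspan
  obtain ⟨c, hc⟩ := hspan
  choose H hH using fun t : Set.range (transitive (G := G)) => t.2
  by_cases hne : ∃ t, c t ≠ 0
  · exfalso
    have hne' : (Finset.univ.filter fun t => c t ≠ 0).Nonempty := by
      obtain ⟨t, ht⟩ := hne
      exact ⟨t, by simpa using ht⟩
    obtain ⟨t, ht, hmax⟩ := Finset.exists_max_image _ (fun t => Nat.card (H t)) hne'
    rw [Finset.mem_filter] at ht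
    have h0 := hx (H t)
    rw [← hc, map_sum, Finset.sum_eq_single t] at h0
    · rw [map_zsmul, smul_eq_mul, mul_eq_zero, ← hH t] at h0
      exact h0.elim ht.2 (fix_transitive_self_ne_zero _)
    · intro s _ hst
      rw [map_zsmul, smul_eq_mul, mul_eq_zero]
      by_contra hcon
      rw [not_or, ← hH s] at hcon
      have h1 := (card_le_of_fix_ne_zero hcon.2).2 (hmax s (by simpa using hcon.1))
      rw [hH, hH] at h1
      exact hst (Subtype.ext h1.symm)
    · intro h
      exact absurd (Finset.mem_univ t) h
  · push Not at hne
    rw [← hc]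
    simp [hne]

end

section

variable {G : Type u} [Group G] {C : Type v} [Group C]

/-- Given subgroups of the same order in groups of the same order, some bijection between the
groups matches the right cosets. -/
theorem exists_equiv_cosets [Finite G] [Finite C] (hGC : Nat.card G = Nat.card C)
    (U : Subgroup G) (V : Subgroup C) (hUV : Nat.card U = Nat.card V) :
    ∃ e : G ≃ C, ∀ a b : G, b * a⁻¹ ∈ U ↔ e b * (e a)⁻¹ ∈ V := by
  have hidx : Nat.card (G ⧸ U) = Nat.card (C ⧸ V) := by
    have h1 := U.card_mul_index
    rw [hGC, ← V.card_mul_index, hUV] at h1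
    exact Nat.eq_of_mul_eq_mul_left Nat.card_pos h1
  have e1 : G ⧸ U ≃ C ⧸ V := (Finite.equivFinOfCardEq hidx).trans (Finite.equivFin _).symm
  have e2 : U ≃ V := (Finite.equivFinOfCardEq hUV).trans (Finite.equivFin _).symm
  have key : ∀ q : G ⧸ U, Nonempty ({a : G // (a : G ⧸ U) = q} ≃ {b : C // (b : C ⧸ V) = e1 q}) := by
    intro q
    have f1 := QuotientGroup.preimageMkEquivSubgroupProdSet U {q}
    have f2 := QuotientGroup.preimageMkEquivSubgroupProdSet V {e1 q}
    exact ⟨f1.trans ((Equiv.prodCongr e2 (Equiv.ofUnique _ _)).trans f2.symm)⟩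
  let f : G ≃ C := (Equiv.sigmaFiberEquiv (fun a : G => (a : G ⧸ U))).symm.trans
    ((Equiv.sigmaCongr e1 fun q => (key q).some).trans
      (Equiv.sigmaFiberEquiv (fun b : C => (b : C ⧸ V))))
  have hf : ∀ a : G, ((f a : C) : C ⧸ V) = e1 (a : G ⧸ U) := fun a =>
    ((key (a : G ⧸ U)).some ⟨a, rfl⟩).2
  refine ⟨(Equiv.inv G).trans (f.trans (Equiv.inv C)), fun a b => ?_⟩
  have h := (e1.apply_eq_iff_eq (x := ((b⁻¹ : G) : G ⧸ U)) (y := ((a⁻¹ : G) : G ⧸ U)))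
  rw [← hf, ← hf, QuotientGroup.eq, QuotientGroup.eq, inv_inv] at h
  simpa using h.symm

open scoped Classical Pointwise in
theorem mem_fixedPoints_powersetCard (k : ℕ) (U : Subgroup G) (S : Set.powersetCard G k) :
    S ∈ MulAction.fixedPoints U (Set.powersetCard G k) ↔
      ∀ a b : G, b * a⁻¹ ∈ U → a ∈ (S : Finset G) → b ∈ (S : Finset G) := by
  constructor
  · intro h a b hab ha
    have h1 : (b * a⁻¹) • (S : Finset G) = S := congrArg Subtype.val (h ⟨b * a⁻¹, hab⟩)
    rw [← h1]
    have := Finset.smul_mem_smul_finset (a := b * a⁻¹) ha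
    simpa using this
  · intro h u
    apply Subtype.ext
    change (u : G) • (S : Finset G) = S
    apply Finset.eq_of_subset_of_card_le
    · intro b hb
      obtain ⟨a, ha, rfl⟩ := Finset.mem_smul_finset.1 hb
      exact h a _ (by simp) ha
    · rw [Finset.card_smul_finset]

open scoped Classical Pointwise in
/-- The number of `U`-invariant `k`-subsets of `G` depends only on the orders of `G` and `U`. -/
theorem card_fixedPoints_powersetCard [Finite G] [Finite C] (hGC : Nat.card G = Nat.card C)
    (U : Subgroup G) (V : Subgroup C) (hUV : Nat.card U = Nat.card V) (k : ℕ) :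
    Nat.card (MulAction.fixedPoints U (Set.powersetCard G k)) =
      Nat.card (MulAction.fixedPoints V (Set.powersetCard C k)) := by
  obtain ⟨e, he⟩ := exists_equiv_cosets hGC U V hUV
  have e1 : ∃ e1 : Set.powersetCard G k ≃ Set.powersetCard C k,
      ∀ S a, e a ∈ (e1 S : Finset C) ↔ a ∈ (S : Finset G) := by
    refine ⟨e.finsetCongr.subtypeEquiv fun S => ?_, fun S a => ?_⟩
    · simp [Set.powersetCard.mem_iff]
    · simp
  obtain ⟨e1, h1⟩ := e1
  refine Nat.card_congr (e1.subtypeEquiv fun S => ?_)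
  rw [mem_fixedPoints_powersetCard, mem_fixedPoints_powersetCard, e.forall_congr_left]
  refine forall_congr' fun a => ?_
  rw [e.forall_congr_left]
  refine forall_congr' fun b => ?_
  rw [he, ← h1, ← h1]
  simp

/-- For a cyclic group `C` of order divisible by `n`, this is the unique subgroup of order `n`. -/
def cyclicSubgroup (C : Type v) [Group C] [IsCyclic C] (n : ℕ) : Subgroup C :=
  letI : CommGroup C := IsCyclic.commGroup
  (powMonoidHom n : C →* C).ker

theorem mem_cyclicSubgroup [IsCyclic C] {n : ℕ} {c : C} : c ∈ cyclicSubgroup C n ↔ c ^ n = 1 :=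
  Iff.rfl

theorem card_cyclicSubgroup [IsCyclic C] [Finite C] {n : ℕ} (hn : n ∣ Nat.card C) :
    Nat.card (cyclicSubgroup C n) = n := by
  let : CommGroup C := IsCyclic.commGroup
  exact (IsCyclic.card_powMonoidHom_ker C n).trans (Nat.gcd_eq_right hn)

theorem eq_cyclicSubgroup [IsCyclic C] [Finite C] {n : ℕ} (D : Subgroup C) (hD : Nat.card D = n) :
    D = cyclicSubgroup C n := by
  refine Subgroup.eq_of_le_of_card_ge (fun d hd => ?_) ?_
  · rw [mem_cyclicSubgroup, ← hD]
    exact congrArg Subtype.val (pow_card_eq_one' (x := (⟨d, hd⟩ : D)))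
  · rw [card_cyclicSubgroup (hD ▸ D.card_subgroup_dvd_card), hD]

/-- The elements of `B(C)` whose numbers of fixed points come from an element of `B(G)`. -/
def liftable (G : Type u) (C : Type v) [Group G] [Group C] [IsCyclic C] :
    AddSubgroup (BurnsideRing C) where
  carrier := {x | ∃ y : BurnsideRing G, ∀ U : Subgroup G,
    fix U y = fix (cyclicSubgroup C (Nat.card U)) x}
  zero_mem' := ⟨0, by simp⟩
  add_mem' := by
    rintro x x' ⟨y, hy⟩ ⟨y', hy'⟩
    exact ⟨y + y', fun U => by rw [map_add, map_add, hy, hy']⟩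
  neg_mem' := by
    rintro x ⟨y, hy⟩
    exact ⟨-y, fun U => by rw [map_neg, map_neg, hy]⟩

open scoped Classical Pointwise in
theorem transitive_mem_liftable [Finite G] [IsCyclic C] [Finite C]
    (h : Nat.card C = Nat.card G) (k : ℕ) :
    ∀ D : Subgroup C, Nat.card D = k → transitive D ∈ liftable G C := by
  induction k using Nat.strong_induction_on with
  | _ k ih =>
    intro D hD
    have : Fintype C := Fintype.ofFinite C
    have hP : of C (Set.powersetCard C k) ∈ liftable G C := by
      refine ⟨of G (Set.powersetCard G k), fun U => ?_⟩
      rw [fix_of, fix_of, card_fixedPoints_powersetCard h.symm U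
        (cyclicSubgroup C (Nat.card U)) (card_cyclicSubgroup (h ▸ U.card_subgroup_dvd_card)).symm]
    have hcard : ((D : Set C).toFinset).card = k := by
      rw [Set.toFinset_card, ← Nat.card_eq_fintype_card]
      exact hD
    let P : Set.powersetCard C k := ⟨(D : Set C).toFinset, hcard⟩
    have hstab : MulAction.stabilizer C P = D := by
      ext c
      rw [MulAction.mem_stabilizer_iff, Subtype.ext_iff]
      change c • (D : Set C).toFinset = (D : Set C).toFinset ↔ c ∈ D
      rw [← Finset.coe_inj, Finset.coe_smul_finset, Set.coe_toFinset]
      rw [← MulAction.mem_stabilizer_iff, MulAction.stabilizer_subgroup]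
    have hsplit := of_eq_add_orbitCompl (G := C) P
    rw [hstab] at hsplit
    rw [eq_sub_of_add_eq hsplit.symm]
    refine AddSubgroup.sub_mem _ hP (of_mem _ _ _ rfl fun Q => ?_)
    refine ih _ ?_ _ rfl
    rw [SubMulAction.stabilizer_of_subMul]
    obtain ⟨Q, hQ⟩ := Q
    change Nat.card (MulAction.stabilizer C Q) < k
    have hkpos : 0 < k := hD ▸ Nat.card_pos
    obtain ⟨s, hs⟩ : (Q : Finset C).Nonempty := by
      rw [← Finset.card_pos, Q.2]
      exact hkpos
    let E := MulAction.stabilizer C Q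
    have hsub : (E : Set C).toFinset.image (· * s) ⊆ (Q : Finset C) := by
      intro b hb
      obtain ⟨g, hg, rfl⟩ := Finset.mem_image.1 hb
      have hg' : g • (Q : Finset C) = Q := congrArg Subtype.val
        (MulAction.mem_stabilizer_iff.1 (Set.mem_toFinset.1 hg))
      rw [← hg']
      exact Finset.smul_mem_smul_finset hs
    have hcE : ((E : Set C).toFinset.image (· * s)).card = Nat.card E := by
      rw [Finset.card_image_of_injective _ (mul_left_injective s), Set.toFinset_card,
        ← Nat.card_eq_fintype_card]
      rfl
    have hle : Nat.card E ≤ k := by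
      rw [← hcE]
      exact (Finset.card_le_card hsub).trans_eq Q.2
    refine lt_of_le_of_ne hle fun hEk => hQ ?_
    have hED : E = D := (eq_cyclicSubgroup E hEk).trans (eq_cyclicSubgroup D hD).symm
    refine ⟨s, ?_⟩
    apply Subtype.ext
    change s • (D : Set C).toFinset = (Q : Finset C)
    rw [← Finset.eq_of_subset_of_card_le hsub (by rw [hcE, hEk, Q.2]), hED]
    let : CommGroup C := IsCyclic.commGroup
    exact Finset.image_congr fun x _ => mul_comm s x

/-- There is a ring homomorphism `α : B(C) → B(G)` with `|α(x)^U| = |x^{C_{|U|}}|` for all `U`. -/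
theorem exists_frobeniusWielandt [Finite G] [IsCyclic C] [Finite C]
    (h : Nat.card C = Nat.card G) :
    ∃ α : BurnsideRing C →+* BurnsideRing G, ∀ (U : Subgroup G) (x : BurnsideRing C),
      fix U (α x) = fix (cyclicSubgroup C (Nat.card U)) x := by
  have hex : ∀ x : BurnsideRing C, x ∈ liftable G C :=
    mem_of_forall_of_mem _ fun X _ _ =>
      of_mem _ _ X rfl fun _ => transitive_mem_liftable h _ _ rfl
  choose f hf using hex
  have ext : ∀ y z : BurnsideRing G, (∀ U : Subgroup G, fix U y = fix U z) → y = z :=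
    fun y z hyz => sub_eq_zero.1 (eq_zero_of_fix _ fun U => by rw [map_sub, hyz, sub_self])
  exact ⟨{
    toFun := f
    map_one' := ext _ _ fun U => by rw [hf, map_one, map_one]
    map_mul' := fun x y => ext _ _ fun U => by rw [map_mul, hf, hf, hf, map_mul]
    map_zero' := ext _ _ fun U => by rw [hf, map_zero, map_zero]
    map_add' := fun x y => ext _ _ fun U => by rw [map_add, hf, hf, hf, map_add] },
    fun U x => hf x U⟩

end

/-- The Frobenius-Wielandt homomorphism `α^G : B(C) → B(G)`, for `C` a cyclic group of order `|G|`: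
the ring homomorphism with `|α^G(x)^U| = |x^{C_{|U|}}|` for all `U ≤ G` and `x ∈ B(C)`. It is unique
by `BurnsideRing.frobeniusWielandt_unique`. -/
noncomputable def frobeniusWielandt (G : Type u) (C : Type v) [Group G] [Finite G] [Group C]
    [IsCyclic C] [Finite C] (h : Nat.card C = Nat.card G) : BurnsideRing C →+* BurnsideRing G :=
  Classical.choose (exists_frobeniusWielandt h)

section

variable {G : Type u} {C : Type v} [Group G] [Finite G] [Group C] [IsCyclic C] [Finite C]

theorem fix_frobeniusWielandt (h : Nat.card C = Nat.card G) (U : Subgroup G)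
    (x : BurnsideRing C) :
    fix U (frobeniusWielandt G C h x) = fix (cyclicSubgroup C (Nat.card U)) x :=
  Classical.choose_spec (exists_frobeniusWielandt h) U x

theorem frobeniusWielandt_unique (h : Nat.card C = Nat.card G)
    (α : BurnsideRing C →+* BurnsideRing G)
    (hα : ∀ (U : Subgroup G) (x : BurnsideRing C),
      fix U (α x) = fix (cyclicSubgroup C (Nat.card U)) x) :
    α = frobeniusWielandt G C h :=
  RingHom.ext fun x => sub_eq_zero.1 (eq_zero_of_fix _ fun U => by
    rw [map_sub, hα, fix_frobeniusWielandt, sub_self])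

end

end BurnsideRing

/-- The gcd property of a group `G` and a subgroup `N`: `|H ∩ N| = gcd(|H|, |N|)` for all `H`. -/
def GcdProperty {G : Type u} [Group G] (N : Subgroup G) : Prop :=
  ∀ H : Subgroup G, Nat.card (H ⊓ N : Subgroup G) = Nat.gcd (Nat.card H) (Nat.card N)

/-! An element of $B(G)$ is determined by its fixed-point numbers (`eq_zero_of_fix`), so both sides
are compared subgroup by subgroup. Since a cyclic group has one subgroup of each possible order,
$|\alpha^G([C/D])^U|$ is $[C:D]$ if $|U|$ divides $|D|$ and $0$ otherwise
(`fix_frobeniusWielandt_transitive`).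

The gcd property amounts to $N$ containing every subgroup whose order divides $|N|$
(`gcdProperty_iff_forall_le`). As conjugation preserves orders, this gives $G/N$ fixed-point numbers
of the same shape (`fix_transitive_of_forall_le`), and they agree with the former once $|N| = |D|$.
Conversely, equality at the trivial subgroup gives $[G:N] = [C:D]$, hence $|N| = |D|$; equality at
$V$ with $|V|$ dividing $|N|$ then says that $V$ fixes all of $G/N$, in particular the coset $N$, so
$V \leqslant N$. -/

/-- The gcd property holds if and only if `N` contains every subgroup whose order divides the order
of `N`. -/
theorem gcdProperty_iff_forall_le {G : Type u} [Group G] [Finite G] (N : Subgroup G) :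
    GcdProperty N ↔ ∀ V : Subgroup G, Nat.card V ∣ Nat.card N → V ≤ N := by
  refine ⟨fun h V hV => ?_, fun h H => Nat.dvd_antisymm ?_ ?_⟩
  · have hcard := h V
    rw [Nat.gcd_eq_left hV] at hcard
    exact inf_eq_left.1 (Subgroup.eq_of_le_of_card_ge inf_le_left hcard.ge)
  · exact Nat.dvd_gcd (Subgroup.card_dvd_of_le inf_le_left) (Subgroup.card_dvd_of_le inf_le_right)
  -- It suffices to treat prime powers $p^k$ dividing the gcd: by Sylow, $H$ has a subgroup of order
  -- $p^k$, and $h$ puts it inside $N$ because $p^k$ divides $|N|$.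
  · rw [Nat.dvd_iff_prime_pow_dvd_dvd]
    intro p k hp hpk
    have : Fact p.Prime := ⟨hp⟩
    obtain ⟨K, hK⟩ := Sylow.exists_subgroup_card_pow_prime p (hpk.trans (Nat.gcd_dvd_left _ _))
    have hcard : Nat.card (K.map H.subtype) = p ^ k := by
      rw [Subgroup.card_map_of_injective H.subtype_injective, hK]
    rw [← hcard]
    refine Subgroup.card_dvd_of_le (le_inf (Subgroup.map_subtype_le K) (h _ ?_))
    rw [hcard]
    exact hpk.trans (Nat.gcd_dvd_right _ _)

/-- In a finite cyclic group, a subgroup contains every subgroup whose order divides its own. -/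
theorem IsCyclic.le_of_card_dvd {C : Type v} [Group C] [Finite C] [IsCyclic C] {V D : Subgroup C}
    (h : Nat.card V ∣ Nat.card D) : V ≤ D := by
  rw [BurnsideRing.eq_cyclicSubgroup V rfl, BurnsideRing.eq_cyclicSubgroup D rfl]
  intro c hc
  rw [BurnsideRing.mem_cyclicSubgroup] at hc ⊢
  exact orderOf_dvd_iff_pow_eq_one.1 ((orderOf_dvd_of_pow_eq_one hc).trans h)

/-! ### Fixed points on coset spaces -/

namespace BurnsideRing

variable {G : Type u} [Group G] [Finite G]

/-- A fixed point of $U$ in $G/N$ is a coset whose stabilizer contains $U$ and has order $|N|$, so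
Lagrange applies. -/
theorem card_dvd_of_fix_ne_zero {U N : Subgroup G} (h : fix U (transitive N) ≠ 0) :
    Nat.card U ∣ Nat.card N := by
  rw [transitive, fix_of, Nat.cast_ne_zero, Nat.card_ne_zero] at h
  obtain ⟨⟨⟨y, hy⟩⟩, -⟩ := h
  rw [← card_stabilizer_quotient N y]
  exact Subgroup.card_dvd_of_le fun u hu => hy ⟨u, hu⟩

/-- `U` fixes every point of `G/N` if and only if all conjugates of `U` lie in `N`. -/
theorem fix_transitive_eq_index_iff {U N : Subgroup G} :
    fix U (transitive N) = N.index ↔ ∀ g : G, ∀ u ∈ U, g⁻¹ * u * g ∈ N := by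
  have hcoset : ∀ g u : G, u • (g : G ⧸ N) = g ↔ g⁻¹ * u * g ∈ N := fun g u => by
    rw [eq_comm, MulAction.Quotient.smul_coe, QuotientGroup.eq, smul_eq_mul, mul_assoc]
  have huniv : fix U (transitive N) = N.index ↔
      MulAction.fixedPoints U (G ⧸ N) = Set.univ := by
    -- The index is the size of $G/N$, and a subset of a finite set with full cardinality is
    -- everything.
    rw [transitive, fix_of, Nat.cast_inj, Subgroup.index, Nat.card_coe_set_eq, ← Set.ncard_univ]
    exact ⟨Set.eq_of_subset_of_ncard_le (Set.subset_univ _) ∘ Eq.ge, congrArg Set.ncard⟩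
  rw [huniv, Set.eq_univ_iff_forall]
  refine ⟨fun h g u hu => (hcoset g u).1 (h g ⟨u, hu⟩), fun h x u => ?_⟩
  induction x using QuotientGroup.induction_on with
  | H g => exact (hcoset g u).2 (h g u u.2)

/-- Every conjugate of $U$ has order $|U|$, so if $|U|$ divides $|N|$ all of them lie in $N$ and
every coset is fixed. Otherwise a single fixed point would force the divisibility. -/
theorem fix_transitive_of_forall_le {N : Subgroup G}
    (h : ∀ V : Subgroup G, Nat.card V ∣ Nat.card N → V ≤ N) (U : Subgroup G) :
    fix U (transitive N) = if Nat.card U ∣ Nat.card N then (N.index : ℤ) else 0 := by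
  split_ifs with hU
  · refine fix_transitive_eq_index_iff.2 fun g u hu => ?_
    refine h (U.map (MulAut.conj g⁻¹).toMonoidHom) ?_ ⟨u, hu, by simp⟩
    rwa [Subgroup.card_map_of_injective (MulAut.conj g⁻¹).injective]
  · exact not_not.1 fun h0 => hU (card_dvd_of_fix_ne_zero h0)

/-- The preceding lemma is applied inside $C$, where every subgroup $D$ meets its hypothesis, to the
subgroup of order $|U|$, which exists because $|U|$ divides $|G| = |C|$. -/
theorem fix_frobeniusWielandt_transitive {C : Type v} [Group C] [Finite C] [IsCyclic C]
    (hC : Nat.card C = Nat.card G) (D : Subgroup C) (U : Subgroup G) :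
    fix U (frobeniusWielandt G C hC (transitive D)) =
      if Nat.card U ∣ Nat.card D then (D.index : ℤ) else 0 := by
  rw [fix_frobeniusWielandt, fix_transitive_of_forall_le fun _ => IsCyclic.le_of_card_dvd,
    card_cyclicSubgroup (hC ▸ U.card_subgroup_dvd_card)]

end BurnsideRing

open BurnsideRing in
theorem mainTheorem6 {G : Type u} [Group G] [Finite G] {C : Type v} [Group C] [Finite C]
    [IsCyclic C] (hC : Nat.card C = Nat.card G) (D : Subgroup C) (N : Subgroup G) :
    BurnsideRing.frobeniusWielandt G C hC (BurnsideRing.transitive D) =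
        BurnsideRing.transitive N ↔
      Nat.card N = Nat.card D ∧ GcdProperty N := by
  have hindex : Nat.card N = Nat.card D ↔ N.index = D.index := by
    have hmul : Nat.card N * N.index = Nat.card D * D.index := by
      rw [N.card_mul_index, D.card_mul_index, hC]
    refine ⟨fun h => ?_, fun h => ?_⟩
    · rw [h] at hmul
      exact Nat.eq_of_mul_eq_mul_left Nat.card_pos hmul
    · rw [h] at hmul
      exact Nat.eq_of_mul_eq_mul_right (Nat.pos_of_ne_zero D.index_ne_zero_of_finite) hmul
  rw [gcdProperty_iff_forall_le]
  constructor
  · intro h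
    have hfix := fix_frobeniusWielandt_transitive hC D
    rw [h] at hfix
    -- The trivial subgroup fixes every point, so here the two sides are the full indices.
    have hbot := hfix ⊥
    rw [fix_transitive_eq_index_iff.2 (by simp), Subgroup.card_bot, if_pos (one_dvd _),
      Nat.cast_inj] at hbot
    have hcard := hindex.2 hbot
    refine ⟨hcard, fun V hV v hv => ?_⟩
    have hVfix := hfix V
    rw [← hcard, if_pos hV, ← hbot] at hVfix
    -- $V$ fixes all of $G/N$; the trivial coset, $g = 1$, already gives $v \in N$.
    simpa using fix_transitive_eq_index_iff.1 hVfix 1 v hv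
  · rintro ⟨hcard, hN⟩
    refine sub_eq_zero.1 (eq_zero_of_fix _ fun U => ?_)
    rw [map_sub, fix_frobeniusWielandt_transitive, fix_transitive_of_forall_le hN,
      hcard, hindex.1 hcard, sub_self]
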